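/- For a group $G$ write $x^y=y^{-1}xy$ and $[x,y]=x^{-1}y^{-1}xy$. Let $G\wedge G$ (the non-abelian exterior square) be the group generated by symbols $x\wedge y$ $(x,y\in G)$ subject to the relations $$xy\wedge z=(x^y\wedge z^y)(y\wedge z),\qquad x\wedge yz=(x\wedge z)(x^z\wedge y^z),\qquad x\wedge x=1$$ for all $x,y,z\in G$. Let $M(G)$ be the kernel of the homomorphism $G\wedge G\to [G,G]$, $x\wedge y\mapsto[x,y]$, let $M_0(G)=\langle x\wedge y\mid x,y\in G,\ [x,y]=1\rangle\le M(G)$, and let $B_0(G)=M(G)/M_0(G)$ be the Bogomolov multiplier of $G$; it is an abelian group. Let $Q$ be a finite group and $S$ a subgroup of $Q$. Then the subgroup $B_0(Q)^{|Q:S|}=\{b^{|Q:S|}\mid b\in B_0(Q)\}$ of $B_0(Q)$ is isomorphic to a subgroup of $B_0(S)$. -/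

import Mathlib

universe u

namespace Bogomolov

/-- The defining relators of the non-abelian exterior square on the symbols `x ∧ y`,
with `x ^ y = y⁻¹ * x * y`. The three families say
`(x * y) ∧ z = (x ^ y ∧ z ^ y) * (y ∧ z)`, `x ∧ (y * z) = (x ∧ z) * (x ^ z ∧ y ^ z)`
and `x ∧ x = 1`. -/
inductive ExteriorRel (Q : Type u) [Group Q] : FreeGroup (Q × Q) → Prop
  | mul_left (x y z : Q) : ExteriorRel Q
      (FreeGroup.of (x * y, z) *
        (FreeGroup.of (y⁻¹ * x * y, y⁻¹ * z * y) * FreeGroup.of (y, z))⁻¹)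
  | mul_right (x y z : Q) : ExteriorRel Q
      (FreeGroup.of (x, y * z) *
        (FreeGroup.of (x, z) * FreeGroup.of (z⁻¹ * x * z, z⁻¹ * y * z))⁻¹)
  | self (x : Q) : ExteriorRel Q (FreeGroup.of (x, x))

/-- The non-abelian exterior square `Q ∧ Q`. -/
abbrev ExteriorSquare (Q : Type u) [Group Q] : Type u :=
  PresentedGroup {r : FreeGroup (Q × Q) | ExteriorRel Q r}

/-- The generator `x ∧ y` of `Q ∧ Q`. -/
def wedge {Q : Type u} [Group Q] (x y : Q) : ExteriorSquare Q :=
  PresentedGroup.of (x, y)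

/-- The commutator homomorphism `Q ∧ Q → Q`, `x ∧ y ↦ [x, y] = x⁻¹ * y⁻¹ * x * y`
(its image is the derived subgroup of `Q`). -/
def commutatorMap (Q : Type u) [Group Q] : ExteriorSquare Q →* Q :=
  PresentedGroup.toGroup (f := fun p : Q × Q => p.1⁻¹ * p.2⁻¹ * p.1 * p.2) (by
    intro r hr
    cases hr with
    | mul_left x y z => simp only [map_mul, map_inv, FreeGroup.lift_apply_of]; group
    | mul_right x y z => simp only [map_mul, map_inv, FreeGroup.lift_apply_of]; group
    | self x => simp only [FreeGroup.lift_apply_of]; group)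

/-- The Schur multiplier `M(Q)`: the kernel of the commutator map on `Q ∧ Q`. -/
def M (Q : Type u) [Group Q] : Subgroup (ExteriorSquare Q) := (commutatorMap Q).ker

/-- `M₀(Q)`, as a subgroup of `M(Q)`: it is generated by the elements `x ∧ y` with
`[x, y] = 1`. -/
def M0 (Q : Type u) [Group Q] : Subgroup (M Q) :=
  Subgroup.closure {m : M Q | ∃ x y : Q, x⁻¹ * y⁻¹ * x * y = 1 ∧
    (m : ExteriorSquare Q) = wedge x y}

theorem commutatorMap_wedge {Q : Type u} [Group Q] (x y : Q) :
    commutatorMap Q (wedge x y) = x⁻¹ * y⁻¹ * x * y :=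
  PresentedGroup.toGroup.of _

theorem wedge_mul_left {Q : Type u} [Group Q] (x y z : Q) :
    wedge (x * y) z = wedge (y⁻¹ * x * y) (y⁻¹ * z * y) * wedge y z := by
  have h := PresentedGroup.one_of_mem (rels := {r : FreeGroup (Q × Q) | ExteriorRel Q r})
    (ExteriorRel.mul_left x y z)
  rw [map_mul, map_inv, map_mul, mul_inv_eq_one] at h
  exact h

theorem wedge_mul_right {Q : Type u} [Group Q] (x y z : Q) :
    wedge x (y * z) = wedge x z * wedge (z⁻¹ * x * z) (z⁻¹ * y * z) := by
  have h := PresentedGroup.one_of_mem (rels := {r : FreeGroup (Q × Q) | ExteriorRel Q r})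
    (ExteriorRel.mul_right x y z)
  rw [map_mul, map_inv, map_mul, mul_inv_eq_one] at h
  exact h

theorem wedge_self {Q : Type u} [Group Q] (x : Q) : wedge x x = 1 :=
  PresentedGroup.one_of_mem (rels := {r : FreeGroup (Q × Q) | ExteriorRel Q r})
    (ExteriorRel.self x)

/-- Expanding `xa ∧ yb` in the two possible ways. -/
theorem wedge_interchange {Q : Type u} [Group Q] (x y a b : Q) :
    wedge ((b * a)⁻¹ * x * (b * a)) ((b * a)⁻¹ * y * (b * a)) * wedge a b =
      wedge a b * wedge ((a * b)⁻¹ * x * (a * b)) ((a * b)⁻¹ * y * (a * b)) := by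
  have h1 : wedge (x * a) (y * b) =
      wedge (a⁻¹ * x * a) (a⁻¹ * b * a) *
        (wedge ((b * a)⁻¹ * x * (b * a)) ((b * a)⁻¹ * y * (b * a)) * wedge a b) *
        wedge (b⁻¹ * a * b) (b⁻¹ * y * b) := by
    rw [wedge_mul_left, wedge_mul_right a y b,
      show a⁻¹ * (y * b) * a = (a⁻¹ * y * a) * (a⁻¹ * b * a) by group, wedge_mul_right]
    simp only [← mul_assoc]
    congr 3
    congr 1 <;> group
  have h2 : wedge (x * a) (y * b) =
      wedge (a⁻¹ * x * a) (a⁻¹ * b * a) *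
        (wedge a b * wedge ((a * b)⁻¹ * x * (a * b)) ((a * b)⁻¹ * y * (a * b))) *
        wedge (b⁻¹ * a * b) (b⁻¹ * y * b) := by
    rw [wedge_mul_right, wedge_mul_left x a b,
      show b⁻¹ * (x * a) * b = (b⁻¹ * x * b) * (b⁻¹ * a * b) by group,
      wedge_mul_left (b⁻¹ * x * b) (b⁻¹ * a * b)]
    simp only [← mul_assoc]
    congr 2
    congr 1 <;> group
  exact mul_left_cancel (mul_right_cancel (h1.symm.trans h2))

/-- An element `t` of `Q ∧ Q` acts on generators by conjugation with its commutator. -/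
theorem wedge_mul_eq {Q : Type u} [Group Q] (t : ExteriorSquare Q) (x y : Q) :
    wedge x y * t = t * wedge ((commutatorMap Q t)⁻¹ * x * commutatorMap Q t)
      ((commutatorMap Q t)⁻¹ * y * commutatorMap Q t) := by
  have key : ∀ t ∈ Subgroup.closure (Set.range
      (PresentedGroup.of (rels := {r : FreeGroup (Q × Q) | ExteriorRel Q r}))), ∀ x y : Q,
      wedge x y * t = t * wedge ((commutatorMap Q t)⁻¹ * x * commutatorMap Q t)
        ((commutatorMap Q t)⁻¹ * y * commutatorMap Q t) := by
    intro t ht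
    induction ht using Subgroup.closure_induction with
    | mem t h =>
      obtain ⟨⟨a, b⟩, rfl⟩ := h
      intro x y
      have h := wedge_interchange (b * a * x * (b * a)⁻¹) (b * a * y * (b * a)⁻¹) a b
      change wedge x y * wedge a b = wedge a b * wedge
        ((commutatorMap Q (wedge a b))⁻¹ * x * commutatorMap Q (wedge a b))
        ((commutatorMap Q (wedge a b))⁻¹ * y * commutatorMap Q (wedge a b))
      rw [commutatorMap_wedge]
      convert h using 3 <;> group
    | one => intro x y; simp
    | mul s t _ _ hs ht =>
      intro x y
      rw [← mul_assoc, hs, mul_assoc, ht, ← mul_assoc]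
      simp only [map_mul, mul_inv_rev, mul_assoc]
    | inv t _ ht =>
      intro x y
      have h := ht (commutatorMap Q t * x * (commutatorMap Q t)⁻¹)
        (commutatorMap Q t * y * (commutatorMap Q t)⁻¹)
      rw [eq_inv_mul_iff_mul_eq, ← mul_assoc, mul_inv_eq_iff_eq_mul]
      simp only [map_inv, inv_inv]
      rw [h]
      congr 2 <;> group
  exact key t (by rw [PresentedGroup.closure_range_of]; trivial) x y

/-- `M(Q)` is central in `Q ∧ Q`. -/
theorem M_le_center (Q : Type u) [Group Q] : M Q ≤ Subgroup.center (ExteriorSquare Q) := by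
  intro t ht
  have ht' : commutatorMap Q t = 1 := ht
  rw [← Subgroup.centralizer_univ, ← Subgroup.coe_top,
    ← PresentedGroup.closure_range_of {r : FreeGroup (Q × Q) | ExteriorRel Q r},
    Subgroup.centralizer_closure, Subgroup.mem_centralizer_iff]
  rintro _ ⟨⟨x, y⟩, rfl⟩
  have h := wedge_mul_eq t x y
  simp only [ht', inv_one, one_mul, mul_one] at h
  exact h

instance M.instCommGroup (Q : Type u) [Group Q] : CommGroup (M Q) :=
  { (inferInstance : Group (M Q)) with
    mul_comm := fun a b => Subtype.ext
      ((Subgroup.mem_center_iff.mp (M_le_center Q b.2)) a) }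

/-- The Bogomolov multiplier `B₀(Q) = M(Q) / M₀(Q)`, an abelian group. -/
abbrev B0 (Q : Type u) [Group Q] : Type u := M Q ⧸ M0 Q

end Bogomolov

/-! Everything rests on a transfer argument. Embed `Q ∧ Q` in a group `E` mapping onto `Q` so that
the commutator of any two elements of `E` is the wedge of their images (`exists_surjective`). Then
`M(Q)` is central in `E`. Let `H` be the preimage of `S`. The transfer `E → H^ab` sends a central
`m` to the class of `m ^ |Q:S|`, but it kills wedges, since they are commutators. So `m ^ |Q:S|`
lies in `[H, H]`, which consists of images of elements of `S ∧ S`; hence it is a corestriction from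
`M(S)` (`pow_index_mem_range_corM`).

Modulo `M₀`, the group `B₀(Q)^|Q:S|` is thus a quotient of a subgroup of `B₀(S)`. As `B₀(S)` is
finite abelian (`finite_M`), character duality turns this quotient into a subgroup. -/

namespace Bogomolov

/-! ### Wedge calculus and the conjugation action on `G ∧ G`. -/

section Wedge

variable {G : Type u} [Group G]

theorem wedge_one_right (x : G) : wedge x 1 = 1 := by
  have h := wedge_mul_right x 1 1
  simpa using h

theorem wedge_mul_self_right (y z : G) : wedge y (y * z) = wedge y z := by
  rw [wedge_mul_right, wedge_self, mul_one]

/-- Expand `u ∧ u = 1` for `u = y * x`, written as `(y * x * y⁻¹) * y` so that the conjugation in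
the left rule cancels. -/
theorem wedge_mul_wedge_swap (x y : G) : wedge x y * wedge y x = 1 := by
  have h := wedge_self ((y * x * y⁻¹) * y)
  rw [wedge_mul_left, wedge_mul_right y _ y, wedge_self, one_mul,
    show y⁻¹ * (y * x * y⁻¹) * y = x by group, show y⁻¹ * y * y = y by group,
    show y⁻¹ * (y * x * y⁻¹ * y) * y = x * y by group, wedge_mul_self_right] at h
  exact h

theorem wedge_swap (x y : G) : wedge y x = (wedge x y)⁻¹ :=
  eq_inv_of_mul_eq_one_right (wedge_mul_wedge_swap x y)

theorem wedge_mul_right_of_commute {x y z : G} (hz : Commute x z) (hyz : Commute y z) :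
    wedge x (y * z) = wedge x z * wedge x y := by
  rw [wedge_mul_right]
  congr 2
  · rw [mul_assoc, hz.eq, inv_mul_cancel_left]
  · rw [mul_assoc, hyz.eq, inv_mul_cancel_left]

theorem wedge_pow_right_eq_one {x y : G} (hc : Commute x y) (h : wedge x y = 1) (n : ℕ) :
    wedge x (y ^ n) = 1 := by
  induction n with
  | zero => rw [pow_zero, wedge_one_right]
  | succ n ih =>
    rw [pow_succ, wedge_mul_right_of_commute hc (Commute.pow_self y n), h, ih, one_mul]

theorem wedge_zpow_right_eq_one {x y : G} (hc : Commute x y) (h : wedge x y = 1) (n : ℤ) :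
    wedge x (y ^ n) = 1 := by
  have hinv : wedge x y⁻¹ = 1 := by
    have h' := wedge_mul_right_of_commute (y := y⁻¹) hc (Commute.refl y).inv_left
    rwa [inv_mul_cancel, wedge_one_right, h, one_mul, eq_comm] at h'
  obtain ⟨n, rfl | rfl⟩ := n.eq_nat_or_neg
  · rw [zpow_natCast, wedge_pow_right_eq_one hc h]
  · rw [zpow_neg, zpow_natCast, ← inv_pow, wedge_pow_right_eq_one hc.inv_right hinv]

theorem wedge_zpow_zpow (x : G) (m n : ℤ) : wedge (x ^ m) (x ^ n) = 1 := by
  refine wedge_zpow_right_eq_one (Commute.zpow_self x m) ?_ n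
  rw [wedge_swap, wedge_zpow_right_eq_one (Commute.refl x) (wedge_self x), inv_one]

/-- Conjugation by `g` on a generator of `G ∧ G` is multiplication by `[x, y] ∧ g`. -/
theorem wedge_mul_wedge_commutator (x y g : G) :
    wedge x y * wedge (x⁻¹ * y⁻¹ * x * y) g = wedge (g⁻¹ * x * g) (g⁻¹ * y * g) := by
  -- `yx ∧ yg` is expanded in two ways; `xy = yx[x, y]` then relates the results.
  have hl : wedge (y * x) (y * g) = wedge x y * wedge (x * y) g := by
    rw [show y * x = (y * x * y⁻¹) * y by group, wedge_mul_left, wedge_mul_self_right,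
      show y⁻¹ * (y * x * y⁻¹) * y = x by group, show y⁻¹ * (y * g) * y = g * y by group,
      wedge_mul_right x g y, mul_assoc, ← wedge_mul_left]
  have hr : wedge (y * x) (y * g) =
      wedge (y * x) g * wedge (g⁻¹ * x * g) (g⁻¹ * y * g) := by
    rw [wedge_mul_left, show x⁻¹ * (y * g) * x = (x⁻¹ * y * x) * (x⁻¹ * g * x) by group,
      wedge_mul_self_right, wedge_mul_right x y g, ← mul_assoc, ← wedge_mul_left]
  have hc := wedge_mul_eq (wedge x y) (y * x) g
  rw [commutatorMap_wedge] at hc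
  have he : wedge x y * wedge (x * y) g =
      wedge (y * x) g * (wedge x y * wedge (x⁻¹ * y⁻¹ * x * y) g) := by
    rw [← mul_assoc, hc, mul_assoc, ← wedge_mul_left]
    congr 2
    group
  exact mul_left_cancel (he.symm.trans (hl.symm.trans hr))

/-- The action of `g` on `G ∧ G` by conjugation, written as `t ↦ t * (∂t ∧ g)`. -/
def wedgeConj (g : G) : ExteriorSquare G →* ExteriorSquare G :=
  MonoidHom.mk' (fun t => t * wedge (commutatorMap G t) g) (by
    intro s t
    have h := wedge_mul_eq t (commutatorMap G s) g
    rw [map_mul, wedge_mul_left, mul_assoc s (wedge _ _), ← mul_assoc (wedge _ _) t, h]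
    simp only [mul_assoc])

theorem wedgeConj_apply (g : G) (t : ExteriorSquare G) :
    wedgeConj g t = t * wedge (commutatorMap G t) g := rfl

theorem wedgeConj_wedge (g x y : G) :
    wedgeConj g (wedge x y) = wedge (g⁻¹ * x * g) (g⁻¹ * y * g) := by
  rw [wedgeConj_apply, commutatorMap_wedge, wedge_mul_wedge_commutator]

/-- Homomorphisms from `G ∧ G` are determined by their values on the symbols `x ∧ y`. -/
theorem exteriorSquare_hom_ext {H : Type*} [Group H] {f f' : ExteriorSquare G →* H}
    (h : ∀ x y, f (wedge x y) = f' (wedge x y)) : f = f' :=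
  PresentedGroup.ext fun p => h p.1 p.2

/-- The Peiffer identity of the crossed module `G ∧ G → G`; it gives the commutator rule in `base`.
-/
theorem wedgeConj_commutatorMap (s t : ExteriorSquare G) :
    wedgeConj (commutatorMap G s) t = s⁻¹ * t * s := by
  have h : wedgeConj (commutatorMap G s) = (MulAut.conj s⁻¹).toMonoidHom :=
    exteriorSquare_hom_ext fun x y => by
      rw [wedgeConj_wedge]
      simp [mul_assoc, wedge_mul_eq s x y]
  rw [h]
  simp

end Wedge

/-! ### Extensions of `G ∧ G` whose commutators are wedges. -/

section Extension

/-- A group `E` over `G` containing `G ∧ G`, in which the commutator of two elements is the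
wedge of their images in `G`. -/
structure WedgeExtension (G : Type u) [Group G] (E : Type u) [Group E] where
  /-- The inclusion of the exterior square. -/
  incl : ExteriorSquare G →* E
  /-- The projection to `G`. -/
  proj : E →* G
  incl_injective : Function.Injective incl
  proj_incl (t : ExteriorSquare G) : proj (incl t) = commutatorMap G t
  commutator_eq (a b : E) : a⁻¹ * b⁻¹ * a * b = incl (wedge (proj a) (proj b))

namespace WedgeExtension

variable {G : Type u} [Group G] {E : Type u} [Group E]

/-- The commutator of `incl t` with `e` is the wedge `∂t ∧ e`, which is the correction factor
defining `wedgeConj`. -/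
theorem conj_incl (X : WedgeExtension G E) (t : ExteriorSquare G) (e : E) :
    e⁻¹ * X.incl t * e = X.incl (wedgeConj (X.proj e) t) := by
  have h := X.commutator_eq (X.incl t) e
  rw [X.proj_incl] at h
  rw [wedgeConj_apply, map_mul, ← h]
  group

/-- The exterior square as an extension over the commutator subgroup. -/
def base (G : Type u) [Group G] : WedgeExtension G (ExteriorSquare G) where
  incl := MonoidHom.id _
  proj := commutatorMap G
  incl_injective := fun _ _ h => h
  proj_incl _ := rfl
  commutator_eq s t := by
    have h := wedgeConj_commutatorMap t s
    rw [wedgeConj_apply] at h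
    rw [MonoidHom.id_apply, ← inv_mul_eq_iff_eq_mul.mpr h.symm]
    group

/-- The right action of `G` on `E` by `e ↦ e * (e ∧ g)`. -/
def act (X : WedgeExtension G E) (g : G) : E →* E :=
  MonoidHom.mk' (fun e => e * X.incl (wedge (X.proj e) g)) (by
    intro a b
    have h := X.conj_incl (wedge (X.proj a) g) b
    rw [wedgeConj_wedge] at h
    rw [map_mul, wedge_mul_left, map_mul, ← h]
    group)

theorem act_apply (X : WedgeExtension G E) (g : G) (e : E) :
    X.act g e = e * X.incl (wedge (X.proj e) g) := rfl

theorem act_incl (X : WedgeExtension G E) (g : G) (t : ExteriorSquare G) :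
    X.act g (X.incl t) = X.incl (wedgeConj g t) := by
  rw [act_apply, X.proj_incl, wedgeConj_apply, map_mul]

theorem act_one (X : WedgeExtension G E) (e : E) : X.act 1 e = e := by
  rw [act_apply, wedge_one_right, map_one, mul_one]

theorem act_act (X : WedgeExtension G E) (g h : G) (e : E) :
    X.act h (X.act g e) = X.act (g * h) e := by
  rw [act_apply X g, map_mul, act_incl, wedgeConj_wedge, act_apply, act_apply,
    wedge_mul_right _ g h, map_mul, mul_assoc]

/-- The left action of `G` on `E` by automorphisms. -/
def actHom (X : WedgeExtension G E) : G →* MulAut E where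
  toFun g :=
    { X.act g⁻¹ with
      invFun := X.act g
      left_inv := fun e => by
        change X.act g (X.act g⁻¹ e) = e
        rw [act_act, inv_mul_cancel, act_one]
      right_inv := fun e => by
        change X.act g⁻¹ (X.act g e) = e
        rw [act_act, mul_inv_cancel, act_one] }
  map_one' := by
    ext e
    change X.act 1⁻¹ e = e
    rw [inv_one, act_one]
  map_mul' g h := by
    ext e
    change X.act (g * h)⁻¹ e = X.act g⁻¹ (X.act h⁻¹ e)
    rw [act_act, mul_inv_rev]

theorem actHom_apply (X : WedgeExtension G E) (g : G) (e : E) :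
    X.actHom g e = X.act g⁻¹ e := rfl

theorem proj_act (X : WedgeExtension G E) (g : G) (e : E) :
    X.proj (X.act g e) = g⁻¹ * X.proj e * g := by
  rw [act_apply, map_mul, X.proj_incl, commutatorMap_wedge]
  group

/-- The action of the cyclic subgroup generated by `x`. -/
abbrev cyclicAct (X : WedgeExtension G E) (x : G) : Subgroup.zpowers x →* MulAut E :=
  X.actHom.comp (Subgroup.zpowers x).subtype

/-- The commutator rule passes to products in the first variable. -/
theorem commutator_mul_left {E' : Type*} [Group E'] {i : ExteriorSquare G →* E'} {p : E' →* G}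
    (hconj : ∀ t e, e⁻¹ * i t * e = i (wedgeConj (p e) t)) {a b c : E'}
    (ha : a⁻¹ * c⁻¹ * a * c = i (wedge (p a) (p c)))
    (hb : b⁻¹ * c⁻¹ * b * c = i (wedge (p b) (p c))) :
    (a * b)⁻¹ * c⁻¹ * (a * b) * c = i (wedge (p (a * b)) (p c)) := by
  have h := hconj (wedge (p a) (p c)) b
  rw [wedgeConj_wedge] at h
  rw [map_mul, wedge_mul_left, map_mul, ← h, ← hb, ← ha]
  group

theorem commutator_swap {E' : Type*} [Group E'] {i : ExteriorSquare G →* E'} {p : E' →* G}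
    {a b : E'} (h : a⁻¹ * b⁻¹ * a * b = i (wedge (p a) (p b))) :
    b⁻¹ * a⁻¹ * b * a = i (wedge (p b) (p a)) := by
  rw [wedge_swap, map_inv, ← h]
  group

/-- Adjoining a preimage of `x`. -/
def adjoin (X : WedgeExtension G E) (x : G) :
    WedgeExtension G (E ⋊[X.cyclicAct x] Subgroup.zpowers x) :=
  let p : (E ⋊[X.cyclicAct x] Subgroup.zpowers x) →* G :=
    SemidirectProduct.lift X.proj (Subgroup.zpowers x).subtype (fun a => by
      ext e
      simp [actHom_apply, proj_act])
  let i : ExteriorSquare G →* (E ⋊[X.cyclicAct x] Subgroup.zpowers x) :=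
    SemidirectProduct.inl.comp X.incl
  have hpl (e : E) : p (SemidirectProduct.inl e) = X.proj e := SemidirectProduct.lift_inl _ _ _ _
  have hpr (a : Subgroup.zpowers x) : p (SemidirectProduct.inr a) = a :=
    SemidirectProduct.lift_inr _ _ _ _
  have hact (e : E) (a : Subgroup.zpowers x) :
      (SemidirectProduct.inr a)⁻¹ * SemidirectProduct.inl e * SemidirectProduct.inr a =
        (SemidirectProduct.inl (X.act a e) : E ⋊[X.cyclicAct x] Subgroup.zpowers x) := by
    have h := SemidirectProduct.inl_aut (φ := X.cyclicAct x) a⁻¹ e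
    rw [MonoidHom.comp_apply, actHom_apply] at h
    simpa using h.symm
  have hconj (t : ExteriorSquare G) (u : E ⋊[X.cyclicAct x] Subgroup.zpowers x) :
      u⁻¹ * i t * u = i (wedgeConj (p u) t) := by
    have hmul (g h : G) : wedgeConj (g * h) t = wedgeConj h (wedgeConj g t) := by
      apply X.incl_injective
      rw [← act_incl, ← act_incl, ← act_incl, act_act]
    rw [← SemidirectProduct.inl_left_mul_inr_right u, map_mul, hpl, hpr, hmul]
    change _ = SemidirectProduct.inl (X.incl _)
    rw [← act_incl, ← hact, ← X.conj_incl]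
    simp only [i, MonoidHom.comp_apply, map_mul, map_inv]
    group
  have hll (e e' : E) := X.commutator_eq e e'
  have hlr (e : E) (a : Subgroup.zpowers x) :
      (SemidirectProduct.inl e)⁻¹ * (SemidirectProduct.inr a)⁻¹ * SemidirectProduct.inl e *
        SemidirectProduct.inr a =
        i (wedge (p (SemidirectProduct.inl e)) (p (SemidirectProduct.inr a))) := by
    rw [hpl, hpr, mul_assoc, mul_assoc, ← mul_assoc _ _ (SemidirectProduct.inr a), hact,
      act_apply, map_mul, inv_mul_cancel_left]
    rfl
  have hrr (a b : Subgroup.zpowers x) :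
      (SemidirectProduct.inr a)⁻¹ * (SemidirectProduct.inr b)⁻¹ * SemidirectProduct.inr a *
        SemidirectProduct.inr b =
        i (wedge (p (SemidirectProduct.inr a)) (p (SemidirectProduct.inr b))) := by
    obtain ⟨_, m, rfl⟩ := a
    obtain ⟨_, n, rfl⟩ := b
    -- Cyclicity is essential here: powers of `x` commute, and their wedges vanish too.
    rw [hpr, hpr, wedge_zpow_zpow, map_one, ← map_inv, ← map_inv, ← map_mul, ← map_mul, ← map_mul]
    refine (congrArg _ (Subtype.ext ?_)).trans (map_one _)
    simp [← zpow_neg, ← zpow_add]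
  { incl := i
    proj := p
    incl_injective := SemidirectProduct.inl_injective.comp X.incl_injective
    proj_incl := fun t => (hpl _).trans (X.proj_incl t)
    commutator_eq := fun u v => by
      rw [← SemidirectProduct.inl_left_mul_inr_right u, ← SemidirectProduct.inl_left_mul_inr_right v]
      -- Multiplicativity in each variable reduces the rule to the two factors.
      refine commutator_mul_left hconj (commutator_swap (commutator_mul_left hconj ?_ ?_))
        (commutator_swap (commutator_mul_left hconj (hlr _ _) (hrr _ _)))
      · have h := congrArg (SemidirectProduct.inl (φ := X.cyclicAct x)) (hll v.left u.left)
        rw [hpl, hpl]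
        simpa only [i, MonoidHom.comp_apply, map_mul, map_inv] using h
      · exact commutator_swap (hlr _ _) }

theorem adjoin_proj_inl (X : WedgeExtension G E) (x : G) (e : E) :
    (X.adjoin x).proj (SemidirectProduct.inl e) = X.proj e := by
  simp [adjoin]

theorem adjoin_proj_inr (X : WedgeExtension G E) (x : G) (a : Subgroup.zpowers x) :
    (X.adjoin x).proj (SemidirectProduct.inr a) = a := by
  simp [adjoin]

/-- Start from `G ∧ G` itself and adjoin one preimage at a time; earlier images persist. -/
theorem exists_mem_range (l : List G) : ∃ (E : Type u) (_ : Group E) (X : WedgeExtension G E),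
    ∀ g ∈ l, g ∈ X.proj.range := by
  induction l with
  | nil => exact ⟨_, _, base G, by simp⟩
  | cons x l ih =>
    obtain ⟨E, _, X, hX⟩ := ih
    refine ⟨_, _, X.adjoin x, fun g hg => ?_⟩
    rcases List.mem_cons.mp hg with rfl | hg
    · exact ⟨_, X.adjoin_proj_inr g ⟨g, Subgroup.mem_zpowers g⟩⟩
    · obtain ⟨e, rfl⟩ := hX g hg
      exact ⟨_, X.adjoin_proj_inl x e⟩

theorem exists_surjective (G : Type u) [Group G] [Finite G] :
    ∃ (E : Type u) (_ : Group E) (X : WedgeExtension G E), Function.Surjective X.proj := by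
  have := Fintype.ofFinite G
  obtain ⟨E, _, X, hX⟩ := exists_mem_range (Finset.univ : Finset G).toList
  exact ⟨E, _, X, fun g => hX g (by simp)⟩

end WedgeExtension

end Extension

/-! ### Corestriction and transfer. -/

section Corestriction

variable {Q : Type u} [Group Q]

/-- The map `S ∧ S → Q ∧ Q` induced by the inclusion of a subgroup. -/
def exteriorCor (S : Subgroup Q) : ExteriorSquare S →* ExteriorSquare Q :=
  PresentedGroup.toGroup (f := fun p : S × S => wedge (p.1 : Q) (p.2 : Q)) (by
    intro r hr
    cases hr with
    | mul_left x y z =>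
      simp only [map_mul, map_inv, FreeGroup.lift_apply_of, mul_inv_eq_one]
      exact wedge_mul_left (x : Q) y z
    | mul_right x y z =>
      simp only [map_mul, map_inv, FreeGroup.lift_apply_of, mul_inv_eq_one]
      exact wedge_mul_right (x : Q) y z
    | self x =>
      simp only [FreeGroup.lift_apply_of]
      exact wedge_self (x : Q))

theorem exteriorCor_wedge (S : Subgroup Q) (x y : S) :
    exteriorCor S (wedge x y) = wedge (x : Q) (y : Q) :=
  PresentedGroup.toGroup.of _

theorem commutatorMap_exteriorCor (S : Subgroup Q) (t : ExteriorSquare S) :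
    commutatorMap Q (exteriorCor S t) = commutatorMap S t := by
  have h : (commutatorMap Q).comp (exteriorCor S) = S.subtype.comp (commutatorMap S) :=
    exteriorSquare_hom_ext fun x y => by
      simp [exteriorCor_wedge, commutatorMap_wedge]
  exact DFunLike.congr_fun h t

/-- Corestriction `M(S) → M(Q)`. -/
def corM (S : Subgroup Q) : M S →* M Q :=
  ((exteriorCor S).comp (M S).subtype).codRestrict (M Q) (fun t => by
    have ht : commutatorMap S t = 1 := t.2
    change commutatorMap Q (exteriorCor S t) = 1
    rw [commutatorMap_exteriorCor, ht, OneMemClass.coe_one])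

theorem coe_corM (S : Subgroup Q) (t : M S) :
    (corM S t : ExteriorSquare Q) = exteriorCor S t := rfl

theorem M0_le_comap_corM (S : Subgroup Q) : M0 S ≤ (M0 Q).comap (corM S) := by
  refine (Subgroup.closure_le _).mpr ?_
  rintro m ⟨x, y, hxy, hm⟩
  refine Subgroup.subset_closure ⟨x, y, ?_, ?_⟩
  · exact_mod_cast congrArg (Subtype.val) hxy
  · rw [coe_corM, hm, exteriorCor_wedge]

/-- Corestriction `B₀(S) → B₀(Q)`. -/
def corB0 (S : Subgroup Q) : B0 S →* B0 Q :=
  QuotientGroup.map (M0 S) (M0 Q) (corM S) (M0_le_comap_corM S)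

/-- Every `|Q : S|`-th power in `M(Q)` comes from `M(S)`. -/
theorem pow_index_mem_range_corM [Finite Q] (S : Subgroup Q) (m : M Q) :
    m ^ S.index ∈ (corM S).range := by
  obtain ⟨E, _, X, hX⟩ := WedgeExtension.exists_surjective Q
  have hm : commutatorMap Q m = 1 := m.2
  let H := S.comap X.proj
  have hidx : H.index = S.index := Subgroup.index_comap_of_surjective S hX
  have : H.FiniteIndex := ⟨by rw [hidx]; exact Subgroup.FiniteIndex.index_ne_zero⟩
  have hcentral (k : ℕ) (e : E) : e⁻¹ * X.incl m ^ k * e = X.incl m ^ k := by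
    rw [← map_pow, X.conj_incl, wedgeConj_apply, map_pow, hm, one_pow, wedge_swap,
      wedge_one_right, inv_one, mul_one]
  have htransfer := MonoidHom.transfer_eq_pow (Abelianization.of (G := H)) (X.incl m)
    (fun k e _ => hcentral k e)
  -- Surjectivity of `proj` makes every wedge a commutator in `E`, and the target is abelian.
  have hone : ((Abelianization.of (G := H)).transfer).comp X.incl = 1 :=
    exteriorSquare_hom_ext fun x y => by
      obtain ⟨a, rfl⟩ := hX x
      obtain ⟨b, rfl⟩ := hX y
      rw [MonoidHom.comp_apply, ← X.commutator_eq]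
      simp only [map_mul, map_inv, MonoidHom.one_apply]
      rw [mul_assoc, mul_comm, mul_comm (_⁻¹)]
      simp
  have hker := (DFunLike.congr_fun hone (m : ExteriorSquare Q)).symm.trans htransfer
  have hcomm : commutator H ≤
      ((X.incl.comp (exteriorCor S)).range).comap H.subtype := by
    rw [commutator_eq_closure, Subgroup.closure_le]
    rintro _ ⟨a, b, rfl⟩
    -- The inverses convert `a * b * a⁻¹ * b⁻¹` to the convention used for wedges.
    refine ⟨wedge ⟨X.proj (a⁻¹ : H), (a⁻¹).2⟩ ⟨X.proj (b⁻¹ : H), (b⁻¹).2⟩, ?_⟩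
    rw [MonoidHom.comp_apply, exteriorCor_wedge, ← X.commutator_eq]
    simp [commutatorElement_def]
  obtain ⟨t, ht⟩ := hcomm ((QuotientGroup.eq_one_iff _).mp hker.symm)
  have ht' : exteriorCor S t = (m : ExteriorSquare Q) ^ S.index := by
    apply X.incl_injective
    rw [map_pow, ← hidx]
    exact ht
  refine ⟨⟨t, ?_⟩, Subtype.ext ht'⟩
  apply Subtype.ext
  rw [← commutatorMap_exteriorCor, ht', map_pow, hm, one_pow, OneMemClass.coe_one]

theorem pow_index_mem_range_corB0 [Finite Q] (S : Subgroup Q) (b : B0 Q) :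
    b ^ S.index ∈ (corB0 S).range := by
  induction b using QuotientGroup.induction_on with
  | H m =>
    obtain ⟨t, ht⟩ := pow_index_mem_range_corM S m
    exact ⟨t, congrArg (QuotientGroup.mk' (M0 Q)) ht⟩

end Corestriction

/-! ### Finiteness of the Schur multiplier. -/

section Finiteness

theorem exteriorSquare_subsingleton (G : Type u) [Group G] [Subsingleton G] (t : ExteriorSquare G) :
    t = 1 := by
  have h : MonoidHom.id (ExteriorSquare G) = 1 := exteriorSquare_hom_ext fun x y => by
    rw [Subsingleton.elim y x, MonoidHom.id_apply, wedge_self, MonoidHom.one_apply]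
  exact DFunLike.congr_fun h t

/-- The Schur multiplier of a finite group is finite. -/
theorem finite_M (G : Type u) [Group G] [Finite G] : Finite (M G) := by
  have hfg : Group.FG (ExteriorSquare G) := by
    rw [Group.fg_iff]
    exact ⟨_, PresentedGroup.closure_range_of _, Set.finite_range _⟩
  have hfi : (M G).FiniteIndex := Subgroup.finiteIndex_ker (commutatorMap G)
  -- A finite-index subgroup of a finitely generated group is finitely generated.
  have hM : Group.FG (M G) := inferInstance
  refine CommGroup.finite_of_fg_isMulTorsion (M G) fun m => ?_
  -- Transfer to the trivial subgroup shows that `|G|` kills `M(G)`.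
  obtain ⟨t, ht⟩ := pow_index_mem_range_corM (⊥ : Subgroup G) m
  have ht1 : t = 1 := Subtype.ext (exteriorSquare_subsingleton _ _)
  rw [isOfFinOrder_iff_pow_eq_one]
  exact ⟨_, Nat.pos_of_ne_zero Subgroup.FiniteIndex.index_ne_zero, by rw [← ht, ht1, map_one]⟩

end Finiteness

/-- A homomorphic image of a finite abelian group embeds into it. -/
theorem exists_injective_of_surjective {A B : Type*} [CommGroup A] [CommGroup B] [Finite A]
    (f : A →* B) (hf : Function.Surjective f) : ∃ g : B →* A, Function.Injective g := by
  have : Finite B := Finite.of_surjective f hf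
  -- Finite abelian groups are (noncanonically) isomorphic to their duals, and the dual of a
  -- surjection is injective.
  obtain ⟨eA⟩ := CommGroup.monoidHom_mulEquiv_of_hasEnoughRootsOfUnity A ℂ
  obtain ⟨eB⟩ := CommGroup.monoidHom_mulEquiv_of_hasEnoughRootsOfUnity B ℂ
  let d : (B →* ℂˣ) →* (A →* ℂˣ) := MonoidHom.compHom' f
  have hd : Function.Injective d := fun χ ψ h => by
    ext b
    obtain ⟨a, rfl⟩ := hf b
    exact congrArg Units.val (DFunLike.congr_fun h a)
  exact ⟨eA.toMonoidHom.comp (d.comp eB.symm.toMonoidHom),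
    eA.injective.comp (hd.comp eB.symm.injective)⟩

end Bogomolov

/-- For a finite group `Q` and `S ≤ Q`, the subgroup `B₀(Q)^|Q:S|` of `|Q:S|`-th powers
embeds into `B₀(S)`. -/
theorem proposition6p2 (Q : Type u) [Group Q] [Finite Q] (S : Subgroup Q) :
    ∃ f : (powMonoidHom S.index : Bogomolov.B0 Q →* Bogomolov.B0 Q).range →* Bogomolov.B0 S,
      Function.Injective f := by
  have := Bogomolov.finite_M S
  let P := (powMonoidHom S.index : Bogomolov.B0 Q →* Bogomolov.B0 Q).range
  -- The image of corestriction may exceed `P`, so it is restricted to the preimage of `P`.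
  let φ : (P.comap (Bogomolov.corB0 S)) →* P := (Bogomolov.corB0 S).subgroupComap P
  have hφ : Function.Surjective φ := by
    rintro ⟨_, b, rfl⟩
    obtain ⟨s, hs⟩ := Bogomolov.pow_index_mem_range_corB0 S b
    exact ⟨⟨s, b, hs.symm⟩, Subtype.ext hs⟩
  obtain ⟨g, hg⟩ := Bogomolov.exists_injective_of_surjective φ hφ
  exact ⟨(P.comap (Bogomolov.corB0 S)).subtype.comp g, Subtype.val_injective.comp hg⟩
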